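/- Let $k\ge 0$, $m=2k+1$, $F=\mathbb F_{2^m}$, let $L\supset F$ be the field with $2^{2m}$ elements and let $T=\mathrm{Tr}_{L/F}$. Write $\mathrm{tr}$ for the absolute trace (of $F$ or of $L$) to $\mathbb F_2$. Let $(V,B)$ be either $V=L$ with $B(x,y)=\mathrm{tr}(xy)$, or $V=F^2$ with $B(x,y)=\mathrm{tr}(x\cdot y)=\mathrm{tr}(x_1y_1+x_2y_2)$. Given $\mathbb F_2$-linear maps $R_z:V\to V$ $(z\in V)$ and $G:V\to V$, put $$\Sigma=\{\{(0,y):y\in V\}\}\cup\{\{(x,R_z(x)):x\in V\}: z\in V\},\qquad \mathcal O=\{x=0\}\cup\{y=G(z)+R_z(x): z\in V\},$$ and, if $\Sigma$ is a spread, let $f:V\times V\to\mathbb F_2$ be given by $f(0,y)=0$, $f(x,R_z(x))=B(G(z),x)$. Here a spread is a set of $|V|+1$ $\mathbb F_2$-subspaces of $V\times V$ of order $|V|$ such that each nonzero vector is in exactly one of them; it is symplectic if each member is totally isotropic for $B(x,y')-B(y,x')$. The affine plane $\mathcal A(\Sigma)$ has as lines the cosets of the members of $\Sigma$; a line oval in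 it is a set of $|V|+1$ affine lines, no three concurrent in the projective completion, whose nucleus is the line at infinity; $E(\mathcal O)$ is the set of points of $V\times V$ on the lines of $\mathcal O$. A function $f:V\times V\to\mathbb F_2$ is bent if $W_f(a,b)=\sum_{x,y}(-1)^{f(x,y)+B(a,x)+B(b,y)}=\pm|V|$ for all $(a,b)$, and its dual $\tilde f$ is given by $(-1)^{\tilde f}|V|=W_f$. * Desarguesian case: $V=L$, $R_z(x)=xz$, $G(z)=\sqrt z$, giving $\Sigma_D,\mathcal O_D,f_D$; put $\mathbf q_D(x,y)=\mathrm{tr}(xy)$ on $L\times L$. * Lüneburg case: $V=F^2$, $a^\sigma=a^{2^{k+1}}$ on $F$, $R_z(x)=xM_z$ with $$M_z=\begin{pmatrix} z_1 & z_1^{\sigma^{-1}}+z_2^{1+\sigma^{-1}}\\ z_1^{\sigma^{-1}}+z_2^{1+\sigma^{-1}} & z_2\end{pmatrix},$$ and $G(z)=d(M_z)$, the vector of square roots of the diagonal entries of $M_z$, giving $\Sigma_L,\mathcal O_L,f_L$; put $\mathbf q_L(x,y)=\mathrm{tr}(x\cdot y)$ on $F^2\times F^2$. Then: 1. $\Sigma_D$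 and $\Sigma_L$ are symplectic spreads, $\mathcal O_D$ and $\mathcal O_L$ are line ovals in $\mathcal A(\Sigma_D)$ and $\mathcal A(\Sigma_L)$, and $d(M_z)=(\sqrt{z_1},\sqrt{z_2})$. 2. $f_D$ and $f_L$ are well defined, bent, and linear on the elements of $\Sigma_D$, resp. $\Sigma_L$. In both cases $\tilde f(x,y)=0$ if and only if $(y,x)\in E(\mathcal O)$. Moreover $f_D(x,y)=\tilde f_D(x,y)=\mathrm{tr}(xy)$. 3. $E(\mathcal O_D)=\{v:\mathbf q_D(v)=0\}$ and $E(\mathcal O_L)=\{v:\mathbf q_L(v)=0\}$, and these are the singular sets of the same quadratic form: $L$ has an $F$-basis $e_1,e_2$ with $T(e_ie_j)=\delta_{ij}$, and for every such basis the isomorphism $\Phi:F^2\times F^2\to L\times L$, $\Phi(x,y)=(\sum x_ie_i,\sum y_ie_i)$, satisfies $\mathbf q_D\circ\Phi=\mathbf q_L$ and $\Phi(E(\mathcal O_L))=E(\mathcal O_D)$. 4. $f_L$ and $f_D$ are EA-equivalent: there are an affine bijection $A:L\times L\to F^2\times F^2$ over $\mathbb F_2$ and an affine function $\ell:L\times L\to\mathbb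 F_2$ with $f_D=f_L\circ A+\ell$. 5. If $k\ge1$, the spreads $\Sigma_L$ and $\Sigma_D$ are inequivalent: no $\mathbb F_2$-linear isomorphism $F^2\times F^2\to L\times L$ carries $\Sigma_L$ onto $\Sigma_D$. Hence for $k\ge1$ bent functions which are linear on the elements of inequivalent spreads can be EA-equivalent. -/

import Mathlib

namespace SpreadBent

noncomputable section

section General

variable {V W : Type*} [AddCommGroup V] [Module (ZMod 2) V] [AddCommGroup W] [Module (ZMod 2) W]

/-- A spread of a `2m`-dimensional `𝔽₂`-space: `2^m + 1` subspaces of dimension `m` such that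
every nonzero vector lies in exactly one of them. -/
def IsSpread (m : ℕ) (Sp : Set (Submodule (ZMod 2) W)) : Prop :=
  Module.finrank (ZMod 2) W = 2 * m ∧
  Sp.ncard = 2 ^ m + 1 ∧
  (∀ S ∈ Sp, Module.finrank (ZMod 2) S = m) ∧
  ∀ v : W, v ≠ 0 → ∃! S : Submodule (ZMod 2) W, S ∈ Sp ∧ v ∈ S

/-- Two spreads are equivalent if an `𝔽₂`-linear isomorphism of the ambient spaces carries the
elements of one onto the elements of the other. -/
def SpreadEquivalent (Sp : Set (Submodule (ZMod 2) V)) (Sp' : Set (Submodule (ZMod 2) W)) : Prop :=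
  ∃ e : V ≃ₗ[ZMod 2] W, (fun S => S.map (e : V →ₗ[ZMod 2] W)) '' Sp = Sp'

/-- `l` is a line of the translation plane `𝒜(Sp)`: a coset of an element of the spread. -/
def IsAffineLine (Sp : Set (Submodule (ZMod 2) W)) (l : Set W) : Prop :=
  ∃ S ∈ Sp, ∃ v : W, l = {w | w - v ∈ S}

/-- A line of `𝒜(Sp)` together with its point at infinity. The points of the projective
completion are the vectors (`Sum.inl`) and the points at infinity (`Sum.inr S`, one for the
parallel class of each `S ∈ Sp`). -/
def extendLine (Sp : Set (Submodule (ZMod 2) W)) (l : Set W) :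
    Set (W ⊕ Submodule (ZMod 2) W) :=
  Sum.inl '' l ∪ Sum.inr '' {S | S ∈ Sp ∧ ∃ v : W, l = {w | w - v ∈ S}}

/-- A line oval in the affine plane `𝒜(Sp)` of order `2^m`: a set of `2^m + 1` affine lines, no
three of which are concurrent in the projective completion, whose nucleus is the line at infinity,
i.e. each point at infinity is on exactly one line of the set. -/
def IsLineOval (m : ℕ) (Sp : Set (Submodule (ZMod 2) W)) (O : Set (Set W)) : Prop :=
  O.ncard = 2 ^ m + 1 ∧
  (∀ l ∈ O, IsAffineLine Sp l) ∧
  (∀ l₁ ∈ O, ∀ l₂ ∈ O, ∀ l₃ ∈ O, l₁ ≠ l₂ → l₁ ≠ l₃ → l₂ ≠ l₃ →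
    ¬ ∃ P, P ∈ extendLine Sp l₁ ∧ P ∈ extendLine Sp l₂ ∧ P ∈ extendLine Sp l₃) ∧
  ∀ S ∈ Sp, ∃! l : Set W, l ∈ O ∧ Sum.inr S ∈ extendLine Sp l

/-- `E(O)`: the points which are on the lines of `O`. -/
def pointsOn (O : Set (Set W)) : Set W := ⋃₀ O

/-- The singular vectors of a quadratic form, including the zero vector. -/
def singularSet (Q : QuadraticForm (ZMod 2) W) : Set W := {v | Q v = 0}

/-- `f` is `𝔽₂`-linear (that is, additive) on each element of the spread. -/
def LinearOnElements (Sp : Set (Submodule (ZMod 2) W)) (f : W → ZMod 2) : Prop :=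
  ∀ S ∈ Sp, ∀ u ∈ S, ∀ v ∈ S, f (u + v) = f u + f v

/-- Extended-affine equivalence of Boolean functions, `g = f ∘ A + ℓ` with `A` an affine bijection
and `ℓ` affine. -/
def EAEquivalent (f : V → ZMod 2) (g : W → ZMod 2) : Prop :=
  ∃ (A : W ≃ᵃ[ZMod 2] V) (ℓ : W →ᵃ[ZMod 2] ZMod 2), ∀ w, g w = f (A w) + ℓ w

/-- The Walsh transform of a Boolean function in bivariate form,
`W_f(a, b) = ∑_{x, y} (-1)^{f(x, y) + B(a, x) + B(b, y)}`. -/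
def walsh [Fintype V] (B : LinearMap.BilinForm (ZMod 2) V) (f : V × V → ZMod 2) (p : V × V) : ℤ :=
  ∑ v : V × V, (-1 : ℤ) ^ (f v + (B p.1 v.1 + B p.2 v.2)).val

/-- `f` on the `2^n`-element space `V × V` is bent: `W_f = ± 2^{n/2} = ± |V|` everywhere. -/
def IsBent [Fintype V] (B : LinearMap.BilinForm (ZMod 2) V) (f : V × V → ZMod 2) : Prop :=
  ∀ p, walsh B f p = (Fintype.card V : ℤ) ∨ walsh B f p = -(Fintype.card V : ℤ)

/-- `g` is the dual of the bent function `f`: `(-1)^{g} 2^{n/2} = W_f`. -/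
def IsDual [Fintype V] (B : LinearMap.BilinForm (ZMod 2) V) (f g : V × V → ZMod 2) : Prop :=
  ∀ p, (-1 : ℤ) ^ (g p).val * (Fintype.card V : ℤ) = walsh B f p

/-- Every element of the spread is totally isotropic for the alternating form
`⟨(x, y), (x', y')⟩ = B(x, y') - B(y, x')`. -/
def IsSymplectic (B : LinearMap.BilinForm (ZMod 2) V)
    (Sp : Set (Submodule (ZMod 2) (V × V))) : Prop :=
  ∀ S ∈ Sp, ∀ u ∈ S, ∀ v ∈ S, B u.1 v.2 - B u.2 v.1 = 0

/-- The quadratic form `𝐪(x, y) = B(x, y)` on `V × V`. -/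
def quadForm (B : LinearMap.BilinForm (ZMod 2) V) : QuadraticForm (ZMod 2) (V × V) :=
  LinearMap.BilinMap.toQuadraticMap
    (B.compl₁₂ (LinearMap.fst (ZMod 2) V V) (LinearMap.snd (ZMod 2) V V))

theorem quadForm_apply (B : LinearMap.BilinForm (ZMod 2) V) (p : V × V) :
    quadForm B p = B p.1 p.2 := rfl

/-- The family consisting of `{(0, y)}` and of the subspaces `{(x, R_z(x))}`, for all `z`. -/
def spreadOf (R : V → V →ₗ[ZMod 2] V) : Set (Submodule (ZMod 2) (V × V)) :=
  insert (Submodule.prod ⊥ ⊤) (Set.range fun z => (R z).graph)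

/-- The set of lines `{x = 0} ∪ {y = G(z) + R_z(x)}`, for all `z`. -/
def linesOf (R : V → V →ₗ[ZMod 2] V) (G : V → V) : Set (Set (V × V)) :=
  insert {p | p.1 = 0} (Set.range fun z => {p | p.2 = G z + R z p.1})

/-- The Boolean function `f(x, y) = B(G(Γ_x(y)), x)`, where `Γ_x` is the inverse of `z ↦ R_z(x)`
for `x ≠ 0`; for `x = 0` the value is `0`. -/
def bentOf (B : LinearMap.BilinForm (ZMod 2) V) (R : V → V →ₗ[ZMod 2] V) (G : V → V)
    (p : V × V) : ZMod 2 :=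
  B (G (Function.invFun (fun z => R z p.1) p.2)) p.1

end General

section Fields

/-- The square root in a finite field of characteristic `2`. -/
def sqrtTwo {K : Type*} [Field K] [Fintype K] (a : K) : K := a ^ (Fintype.card K / 2)

theorem sqrtTwo_sq {K : Type*} [Field K] [Fintype K] (h : 2 ∣ Fintype.card K) (a : K) :
    sqrtTwo a ^ 2 = a := by
  rw [sqrtTwo, ← pow_mul, Nat.div_mul_cancel h, FiniteField.pow_card]

/-- `d(M)`: the vector of the square roots of the diagonal entries of `M`. -/
def diagSqrt {K : Type*} [Field K] [Fintype K] {n : ℕ} (M : Matrix (Fin n) (Fin n) K) :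
    Fin n → K :=
  fun i => sqrtTwo (M i i)

/-- The Desarguesian multiplication maps `R_z(x) = x z`. -/
def desMul (L : Type*) [Field L] [Algebra (ZMod 2) L] (z : L) : L →ₗ[ZMod 2] L :=
  LinearMap.mulRight (ZMod 2) z

/-- The form `B(x, y) = tr(x y)` on a field. -/
def desForm (L : Type*) [Field L] [Algebra (ZMod 2) L] : LinearMap.BilinForm (ZMod 2) L :=
  Algebra.traceForm (ZMod 2) L

/-- The automorphism `σ` of the field with `2^(2k+1)` elements, `a^σ = a^(2^(k+1))`. -/
def lunSigma {F : Type*} [Field F] (k : ℕ) (a : F) : F := a ^ 2 ^ (k + 1)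

/-- The inverse `σ⁻¹` of `σ` on the field with `2^(2k+1)` elements. -/
def lunSigmaInv {F : Type*} [Field F] (k : ℕ) (a : F) : F := a ^ 2 ^ k

theorem lunSigma_lunSigmaInv {F : Type*} [Field F] [Fintype F] {k : ℕ}
    (h : Fintype.card F = 2 ^ (2 * k + 1)) (a : F) : lunSigma k (lunSigmaInv k a) = a := by
  rw [lunSigma, lunSigmaInv, ← pow_mul, ← pow_add, show k + (k + 1) = 2 * k + 1 by ring, ← h,
    FiniteField.pow_card]

theorem lunSigmaInv_lunSigma {F : Type*} [Field F] [Fintype F] {k : ℕ}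
    (h : Fintype.card F = 2 ^ (2 * k + 1)) (a : F) : lunSigmaInv k (lunSigma k a) = a := by
  rw [lunSigma, lunSigmaInv, ← pow_mul, ← pow_add, show k + 1 + k = 2 * k + 1 by ring, ← h,
    FiniteField.pow_card]

/-- The Lüneburg matrices: the symmetric matrix `M_z` with diagonal `z₁, z₂` and off-diagonal
entry `z₁^(σ⁻¹) + z₂^(1 + σ⁻¹)`. -/
def lunMatrix {F : Type*} [Field F] (k : ℕ) (z : Fin 2 → F) : Matrix (Fin 2) (Fin 2) F :=
  !![z 0, lunSigmaInv k (z 0) + z 1 * lunSigmaInv k (z 1);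
     lunSigmaInv k (z 0) + z 1 * lunSigmaInv k (z 1), z 1]

/-- The Lüneburg multiplication maps `R_z(x) = x ∘ z = x M_z` on row vectors. -/
def lunMul (F : Type*) [Field F] [Algebra (ZMod 2) F] (k : ℕ) (z : Fin 2 → F) :
    (Fin 2 → F) →ₗ[ZMod 2] (Fin 2 → F) :=
  (Matrix.vecMulLinear (lunMatrix k z)).restrictScalars (ZMod 2)

theorem lunMul_apply (F : Type*) [Field F] [Algebra (ZMod 2) F] (k : ℕ) (z x : Fin 2 → F) :
    lunMul F k z x = Matrix.vecMul x (lunMatrix k z) := rfl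

/-- `d(z) = d(M_z)`. -/
def lunD (F : Type*) [Field F] [Fintype F] (k : ℕ) (z : Fin 2 → F) : Fin 2 → F :=
  diagSqrt (lunMatrix k z)

/-- The form `B(x, y) = tr(x · y)` on `F²`. -/
def lunForm (F : Type*) [Field F] [Algebra (ZMod 2) F] :
    LinearMap.BilinForm (ZMod 2) (Fin 2 → F) :=
  LinearMap.mk₂ (ZMod 2) (fun x y => Algebra.trace (ZMod 2) F (dotProduct x y))
    (fun x x' y => by rw [add_dotProduct, map_add])
    (fun c x y => by rw [smul_dotProduct, map_smul])
    (fun x y y' => by rw [dotProduct_add, map_add])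
    (fun c x y => by rw [dotProduct_smul, map_smul])

end Fields

section Objects

/-- The Desarguesian spread of `L × L`. -/
def desSpread (L : Type*) [Field L] [Algebra (ZMod 2) L] : Set (Submodule (ZMod 2) (L × L)) :=
  spreadOf (desMul L)

/-- The lines `x = 0` and `y = √z + x z`. -/
def desOval (L : Type*) [Field L] [Fintype L] [Algebra (ZMod 2) L] : Set (Set (L × L)) :=
  linesOf (desMul L) sqrtTwo

/-- The Boolean function built from the Desarguesian spread and its line oval. -/
def desBent (L : Type*) [Field L] [Fintype L] [Algebra (ZMod 2) L] : L × L → ZMod 2 :=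
  bentOf (desForm L) (desMul L) sqrtTwo

/-- The Lüneburg spread of `F² × F²`. -/
def lunSpread (F : Type*) [Field F] [Algebra (ZMod 2) F] (k : ℕ) :
    Set (Submodule (ZMod 2) ((Fin 2 → F) × (Fin 2 → F))) :=
  spreadOf (lunMul F k)

/-- The lines `x = 0` and `y = d(M_z) + x M_z`. -/
def lunOval (F : Type*) [Field F] [Fintype F] [Algebra (ZMod 2) F] (k : ℕ) :
    Set (Set ((Fin 2 → F) × (Fin 2 → F))) :=
  linesOf (lunMul F k) (lunD F k)

/-- The Boolean function built from the Lüneburg spread and its line oval. -/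
def lunBent (F : Type*) [Field F] [Fintype F] [Algebra (ZMod 2) F] (k : ℕ) :
    (Fin 2 → F) × (Fin 2 → F) → ZMod 2 :=
  bentOf (lunForm F) (lunMul F k) (lunD F k)

/-- The basis `e` of `L` over `F` is orthonormal for the trace form `T(x y)`. -/
def IsTraceOrthonormal {F L : Type*} [Field F] [Field L] [Algebra F L]
    (e : Module.Basis (Fin 2) F L) : Prop :=
  ∀ i j, Algebra.trace F L (e i * e j) = if i = j then 1 else 0

/-- The identification `(x, y) ↦ (∑ xᵢ eᵢ, ∑ yᵢ eᵢ)` of `F² × F²` with `L × L`. -/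
def coordMap {F L : Type*} [Field F] [Field L] [Algebra F L]
    (e : Module.Basis (Fin 2) F L) :
    ((Fin 2 → F) × (Fin 2 → F)) ≃ₗ[F] (L × L) :=
  LinearEquiv.prodCongr e.equivFun.symm e.equivFun.symm

end Objects

end

end SpreadBent

open SpreadBent

/-! Both cases share one mechanism, isolated in `IsSymplecticSpreadSet`: the `R z` are self-adjoint,
`z ↦ R z x` is injective for `x ≠ 0`, and `G z` represents the additive function `x ↦ B x (R z x)`.
Then `f(x, R_z(x)) = B(G(z), x) = B(x, R_z(x))`, so `f` is the hyperbolic quadratic form `B(x, y)`,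
whatever the spread (`bentOf_apply`). Bentness, self-duality and linearity on totally isotropic
subspaces follow at once.

The oval is governed by one character sum (`card_lines`): the number of lines `y = G(z) + R_z(x)`
through `(x, y)` is `1 + (-1)^B(x, y)`, hence `0` or `2`, when `x ≠ 0`, and is `1` when `x = 0`. So
no three lines meet, and the covered points are the zeros of `B(x, y)`.

For Lüneburg matrices, injectivity is the nonvanishing of `det (M_z - M_w)`, forced by `tr 1 = 1` in
odd degree. A trace-orthonormal basis carries one form `B` to the other, so the two bent functions
correspond linearly. The spreads differ for `k ≥ 1`: maps defining a spread equivalent to the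
Desarguesian one are closed under addition once they include `0`, but `a ↦ a^(1+σ⁻¹)` is not
additive. -/

namespace SpreadBent

/-! ### Character sums over `𝔽₂`-spaces -/

section CharacterSums

variable {V : Type*} [AddCommGroup V] [Module (ZMod 2) V]

/-- The nontrivial character of `𝔽₂`. -/
def signChar (a : ZMod 2) : ℤ := (-1) ^ a.val

theorem signChar_add (a b : ZMod 2) : signChar (a + b) = signChar a * signChar b := by
  revert a b; decide

theorem signChar_zero : signChar 0 = 1 := rfl

theorem signChar_one : signChar 1 = -1 := rfl

theorem eq_zero_or_eq_one (a : ZMod 2) : a = 0 ∨ a = 1 := by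
  revert a; decide

/-- Translating `y` by a `y₀` with `B c y₀ = 1` reverses the sign of the sum. -/
theorem sum_signChar_form [Fintype V] [DecidableEq V] {B : LinearMap.BilinForm (ZMod 2) V}
    (hB : B.SeparatingLeft) (c : V) :
    ∑ y, signChar (B c y) = if c = 0 then (Fintype.card V : ℤ) else 0 := by
  split_ifs with hc
  · simp [hc, signChar_zero]
  · obtain ⟨y₀, hy₀⟩ : ∃ y, B c y ≠ 0 := by
      by_contra! h
      exact hc (hB c h)
    have h1 : B c y₀ = 1 := (eq_zero_or_eq_one _).resolve_left hy₀
    have h2 : ∑ y, signChar (B c y) = ∑ y, signChar (B c (y + y₀)) :=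
      (Equiv.sum_comp (Equiv.addRight y₀) fun y => signChar (B c y)).symm
    simp only [map_add, signChar_add, h1, signChar_one, mul_neg, mul_one,
      Finset.sum_neg_distrib] at h2
    linarith

end CharacterSums

/-! ### Symplectic spread sets, their bent functions and line counts -/

/-- The data `z ↦ R_z` of a symplectic spread together with a map `G` giving the diagonals of the
quadratic forms `x ↦ B(x, R_z(x))`. -/
structure IsSymplecticSpreadSet {V : Type*} [AddCommGroup V] [Module (ZMod 2) V]
    (B : LinearMap.BilinForm (ZMod 2) V) (R : V → V →ₗ[ZMod 2] V) (G : V → V) : Prop where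
  separating : B.SeparatingLeft
  symm : ∀ x y, B x y = B y x
  injective : ∀ x, x ≠ 0 → Function.Injective fun z => R z x
  selfAdjoint : ∀ z x y, B x (R z y) = B (R z x) y
  diag : ∀ z x, B (G z) x = B x (R z x)

namespace IsSymplecticSpreadSet

variable {V : Type*} [AddCommGroup V] [Module (ZMod 2) V]
  {B : LinearMap.BilinForm (ZMod 2) V} {R : V → V →ₗ[ZMod 2] V} {G : V → V}

theorem isSymplectic (h : IsSymplecticSpreadSet B R G) : IsSymplectic B (spreadOf R) := by
  rintro S (rfl | ⟨z, rfl⟩) u hu v hv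
  · simp only [Submodule.mem_prod, Submodule.mem_bot] at hu hv
    simp [hu.1, hv.1]
  · rw [LinearMap.mem_graph_iff] at hu hv
    rw [hu, hv, h.selfAdjoint, sub_self]

/-- A line determines its direction; distinctness of lines is reduced to distinctness of spread
elements through this. -/
theorem coset_injective {S T : Submodule (ZMod 2) (V × V)} {u v : V × V}
    (hST : {w | w - u ∈ S} = {w | w - v ∈ T}) : S = T := by
  have hu : u - v ∈ T := by
    have : u ∈ {w | w - u ∈ S} := by simp
    rwa [hST] at this
  ext w
  have h1 : w + u ∈ {w | w - u ∈ S} ↔ w ∈ S := by simp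
  rw [← h1, hST, Set.mem_ofPred_eq, add_sub_assoc, Submodule.add_mem_iff_left _ hu]

theorem vertical_eq_coset : {p : V × V | p.1 = 0} =
    {w | w - 0 ∈ Submodule.prod (⊥ : Submodule (ZMod 2) V) (⊤ : Submodule (ZMod 2) V)} := by
  ext
  simp

theorem line_eq_coset (R : V → V →ₗ[ZMod 2] V) (G : V → V) (z : V) :
    {p : V × V | p.2 = G z + R z p.1} = {w | w - (0, G z) ∈ (R z).graph} := by
  ext p
  simp [LinearMap.mem_graph_iff, sub_eq_iff_eq_add']

theorem vertical_ne_graph [Nontrivial V] (T : V →ₗ[ZMod 2] V) :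
    Submodule.prod (⊥ : Submodule (ZMod 2) V) (⊤ : Submodule (ZMod 2) V) ≠ T.graph := by
  intro hT
  obtain ⟨x, hx⟩ := exists_ne (0 : V)
  have h1 : (x, T x) ∈ T.graph := by simp [LinearMap.mem_graph_iff]
  rw [← hT, Submodule.mem_prod] at h1
  exact hx (by simpa using h1.1)

theorem injective_graph [Nontrivial V] (h : IsSymplecticSpreadSet B R G) :
    Function.Injective fun z => (R z).graph := by
  intro z w hzw
  obtain ⟨x, hx⟩ := exists_ne (0 : V)
  have h1 : (x, R z x) ∈ (R w).graph := by
    rw [← show (R z).graph = (R w).graph from hzw]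
    simp [LinearMap.mem_graph_iff]
  exact h.injective x hx ((LinearMap.mem_graph_iff (R w) (x, R z x)).mp h1)

theorem existsUnique_line [Nontrivial V] (h : IsSymplecticSpreadSet B R G) {S : Submodule (ZMod 2) (V × V)}
    (hS : S ∈ spreadOf R) :
    ∃! l : Set (V × V), l ∈ linesOf R G ∧ Sum.inr S ∈ extendLine (spreadOf R) l := by
  have hinr : ∀ l : Set (V × V), Sum.inr S ∈ extendLine (spreadOf R) l ↔
      ∃ v, l = {w | w - v ∈ S} := by
    intro l
    simp [extendLine, hS]
  simp only [hinr]
  obtain rfl | ⟨z, rfl⟩ := hS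
  · refine ⟨_, ⟨Or.inl rfl, 0, vertical_eq_coset⟩, ?_⟩
    rintro l ⟨rfl | ⟨w, rfl⟩, v, hv⟩
    · rfl
    · exact absurd (coset_injective ((line_eq_coset R G w).symm.trans hv)).symm
        (vertical_ne_graph _)
  · refine ⟨_, ⟨Or.inr ⟨z, rfl⟩, _, line_eq_coset R G z⟩, ?_⟩
    rintro l ⟨rfl | ⟨w, rfl⟩, v, hv⟩
    · exact absurd (coset_injective (vertical_eq_coset.symm.trans hv)) (vertical_ne_graph _)
    · have := h.injective_graph (coset_injective ((line_eq_coset R G w).symm.trans hv))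
      rw [this]

variable [Fintype V]

theorem bijective (h : IsSymplecticSpreadSet B R G) {x : V} (hx : x ≠ 0) :
    Function.Bijective fun z => R z x :=
  Finite.injective_iff_bijective.mp (h.injective x hx)

/-- Writing `y = R_z(x)`, the condition `diag` turns `B(G(z), x)` into `B(x, y)`, and `z`
disappears. -/
theorem bentOf_apply (h : IsSymplecticSpreadSet B R G) (p : V × V) :
    bentOf B R G p = B p.1 p.2 := by
  by_cases hx : p.1 = 0
  -- Here `Function.invFun` returns an irrelevant value, which is paired with `0`.
  · simp [bentOf, hx]
  · have hy : R (Function.invFun (fun z => R z p.1) p.2) p.1 = p.2 :=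
      Function.rightInverse_invFun (h.bijective hx).2 p.2
    rw [bentOf, h.diag, hy]

theorem bentOf_graph (h : IsSymplecticSpreadSet B R G) (x z : V) :
    bentOf B R G (x, R z x) = B (G z) x := by
  rw [h.bentOf_apply, h.diag]

/-- The polarization of `B(x, y)` is the alternating form, which vanishes on spread elements. -/
theorem linearOnElements (h : IsSymplecticSpreadSet B R G) :
    LinearOnElements (spreadOf R) (bentOf B R G) := by
  intro S hS u hu v hv
  have h1 := sub_eq_zero.mp (h.isSymplectic S hS u hu v hv)
  have h2 : B u.1 v.2 + B v.1 u.2 = 0 := by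
    rw [h1, h.symm v.1]
    exact CharTwo.add_self_eq_zero _
  simp only [h.bentOf_apply, Prod.fst_add, Prod.snd_add, map_add, LinearMap.add_apply]
  linear_combination h2

/-- For fixed `x` the sum over `y` vanishes unless `x = p.2`, so one term survives. -/
theorem walsh_bentOf (h : IsSymplecticSpreadSet B R G) (p : V × V) :
    walsh B (bentOf B R G) p = signChar (B p.1 p.2) * Fintype.card V := by
  classical
  have key : ∀ x y, signChar (bentOf B R G (x, y) + (B p.1 x + B p.2 y)) =
      signChar (B p.1 x) * signChar (B (x + p.2) y) := by
    intro x y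
    rw [← signChar_add, h.bentOf_apply]
    congr 1
    simp only [map_add, LinearMap.add_apply]
    ring
  have hs : ∀ x : V, x + p.2 = 0 ↔ x = p.2 := by
    intro x
    rw [← ZModModule.sub_eq_add, sub_eq_zero]
  change ∑ v : V × V, signChar (bentOf B R G v + (B p.1 v.1 + B p.2 v.2)) = _
  rw [Fintype.sum_prod_type]
  simp only [key, ← Finset.mul_sum, sum_signChar_form h.separating, hs]
  simp

theorem isDual_form (h : IsSymplecticSpreadSet B R G) :
    IsDual B (bentOf B R G) fun p => B p.1 p.2 :=
  fun p => (h.walsh_bentOf p).symm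

theorem isBent (h : IsSymplecticSpreadSet B R G) : IsBent B (bentOf B R G) := by
  intro p
  rw [h.walsh_bentOf]
  rcases eq_zero_or_eq_one (B p.1 p.2) with h0 | h0 <;> simp [h0, signChar_zero, signChar_one]

/-- The number of lines `y = G(z) + R_z(x)` through a point, up to the factor `|V|`. -/
theorem card_mul_card_lines [DecidableEq V] (h : IsSymplecticSpreadSet B R G) (x y : V) :
    (Fintype.card V : ℤ) * (Finset.univ.filter fun z => y = G z + R z x).card =
      Fintype.card V * (if x = 0 then 1 else 1 + signChar (B x y)) := by
  have h1 : ∑ z, ∑ b, signChar (B (y - (G z + R z x)) b) =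
      (Fintype.card V : ℤ) * (Finset.univ.filter fun z => y = G z + R z x).card := by
    simp only [sum_signChar_form h.separating, sub_eq_zero]
    rw [Finset.sum_ite]
    simp [mul_comm]
  -- By `diag`, `B(G(z), b) = B(b, R_z(b))`, which merges with `B(b, R_z(x))`.
  have h2 : ∀ z b, signChar (B (y - (G z + R z x)) b) =
      signChar (B b y) * signChar (B b (R z (x + b))) := by
    intro z b
    rw [← signChar_add, ZModModule.sub_eq_add]
    congr 1
    simp only [map_add, LinearMap.add_apply, h.diag, h.symm _ b]
    ring
  -- For `x + b ≠ 0` the vector `R_z(x + b)` runs over all of `V`, so only `b = 0` and `b = x`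
  -- contribute; these coincide when `x = 0`.
  have h3 : ∀ b, ∑ z, signChar (B b (R z (x + b))) =
      if b = 0 ∨ b = x then (Fintype.card V : ℤ) else 0 := by
    intro b
    by_cases hb : x + b = 0
    · have : b = x := by rw [← ZModModule.sub_eq_add, sub_eq_zero] at hb; exact hb.symm
      simp [this, signChar_zero, ZModModule.add_self]
    · have hbx : b ≠ x := by
        rintro rfl
        exact hb (ZModModule.add_self b)
      rw [Function.Bijective.sum_comp (h.bijective hb) fun v => signChar (B b v),
        sum_signChar_form h.separating]
      simp [hbx]
  rw [← h1, Finset.sum_comm]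
  simp only [h2, ← Finset.mul_sum, h3, mul_ite, mul_zero]
  rw [← Finset.sum_filter]
  by_cases hx : x = 0
  · have : (Finset.univ.filter fun b : V => b = 0 ∨ b = x) = {0} := by ext; simp [hx]
    rw [this, Finset.sum_singleton]
    simp [hx, signChar_zero]
  · have : (Finset.univ.filter fun b : V => b = 0 ∨ b = x) = {0, x} := by ext; simp
    rw [this, Finset.sum_pair (Ne.symm hx)]
    simp only [map_zero, LinearMap.zero_apply, signChar_zero, if_neg hx]
    ring

theorem card_lines [DecidableEq V] (h : IsSymplecticSpreadSet B R G) (x y : V) :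
    ((Finset.univ.filter fun z => y = G z + R z x).card : ℤ) =
      if x = 0 then 1 else 1 + signChar (B x y) :=
  mul_left_cancel₀ (by simp) (h.card_mul_card_lines x y)

/-- Equivalently, `G` is a bijection. -/
theorem card_lines_zero [DecidableEq V] (h : IsSymplecticSpreadSet B R G) (y : V) :
    (Finset.univ.filter fun z => y = G z + R z 0).card = 1 := by
  have := h.card_lines 0 y
  rw [if_pos rfl] at this
  exact_mod_cast this

theorem card_lines_le [DecidableEq V] (h : IsSymplecticSpreadSet B R G) (x y : V) :
    (Finset.univ.filter fun z => y = G z + R z x).card ≤ 2 := by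
  have h1 := h.card_lines x y
  zify
  rw [h1]
  split_ifs
  · norm_num
  · rcases eq_zero_or_eq_one (B x y) with h0 | h0 <;> simp [h0, signChar_zero, signChar_one]

theorem pointsOn_linesOf (h : IsSymplecticSpreadSet B R G) :
    pointsOn (linesOf R G) = singularSet (quadForm B) := by
  classical
  ext ⟨x, y⟩
  have h0 : (x, y) ∈ pointsOn (linesOf R G) ↔ x = 0 ∨ ∃ z, y = G z + R z x := by
    simp [pointsOn, linesOf]
  rw [h0, singularSet, Set.mem_ofPred_eq, quadForm_apply]
  by_cases hx : x = 0
  · simp [hx]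
  · have h1 : (∃ z, y = G z + R z x) ↔
        (Finset.univ.filter fun z => y = G z + R z x).card ≠ 0 := by
      rw [Finset.card_ne_zero, Finset.filter_nonempty_iff]
      simp
    have h2 := h.card_lines x y
    rw [if_neg hx] at h2
    simp only [hx, false_or, h1]
    rcases eq_zero_or_eq_one (B x y) with h3 | h3
    · simp only [h3, signChar_zero] at h2 ⊢
      simp only [ne_eq, iff_true]
      omega
    · simp only [h3, signChar_one] at h2 ⊢
      simp only [one_ne_zero, iff_false, not_not]
      omega

theorem isDual_indicator (h : IsSymplecticSpreadSet B R G) :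
    IsDual B (bentOf B R G) fun p => 1 + (pointsOn (linesOf R G)).indicator 1 p.swap := by
  have : (fun p : V × V => 1 + (pointsOn (linesOf R G)).indicator (1 : V × V → ZMod 2) p.swap) =
      fun p => B p.1 p.2 := by
    funext p
    -- The swap is harmless because `B` is symmetric.
    have hp : p.swap ∈ pointsOn (linesOf R G) ↔ B p.1 p.2 = 0 := by
      rw [h.pointsOn_linesOf, singularSet, Set.mem_ofPred_eq, quadForm_apply, h.symm]
      rfl
    rcases eq_zero_or_eq_one (B p.1 p.2) with h0 | h0
    · rw [Set.indicator_of_mem (hp.mpr h0), h0]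
      rfl
    · rw [Set.indicator_of_notMem (by rw [hp, h0]; exact one_ne_zero), h0]
      rfl
  rw [this]
  exact h.isDual_form

/-! ### Spreads and line ovals -/

section Planes

variable [Nontrivial V]

theorem isSpread (h : IsSymplecticSpreadSet B R G) {n : ℕ} (hn : Fintype.card V = 2 ^ n) :
    IsSpread n (spreadOf R) := by
  have hfin : Module.finrank (ZMod 2) V = n := by
    have := Module.card_eq_pow_finrank (K := ZMod 2) (V := V)
    rw [hn, ZMod.card] at this
    exact (Nat.pow_right_injective le_rfl this).symm
  refine ⟨by rw [Module.finrank_prod, hfin, two_mul], ?_, ?_, ?_⟩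
  · rw [spreadOf, Set.ncard_insert_of_notMem _ (Set.finite_range _),
      ← Set.image_univ, Set.ncard_image_of_injective _ h.injective_graph, Set.ncard_univ,
      Nat.card_eq_fintype_card, hn]
    rintro ⟨z, hz⟩
    exact vertical_ne_graph (R z) hz.symm
  · rintro S (rfl | ⟨z, rfl⟩)
    · have hr : Submodule.prod (⊥ : Submodule (ZMod 2) V) (⊤ : Submodule (ZMod 2) V) =
          LinearMap.range (LinearMap.inr (ZMod 2) V V) := by
        ext p
        simp [Prod.ext_iff, eq_comm]
      rw [hr, LinearMap.finrank_range_of_inj LinearMap.inr_injective, hfin]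
    · change Module.finrank (ZMod 2) (R z).graph = n
      rw [LinearMap.graph_eq_range_prod, LinearMap.finrank_range_of_inj, hfin]
      intro x y hxy
      exact congrArg Prod.fst hxy
  · rintro ⟨x, y⟩ hv
    by_cases hx : x = 0
    · refine ⟨_, ⟨Or.inl rfl, by simp [hx]⟩, ?_⟩
      rintro S ⟨rfl | ⟨z, rfl⟩, hS⟩
      · rfl
      · rw [LinearMap.mem_graph_iff] at hS
        simp [hx] at hS
        simp [hx, hS] at hv
    · obtain ⟨z, hz⟩ := (h.bijective hx).2 y
      refine ⟨_, ⟨Or.inr ⟨z, rfl⟩, by rw [LinearMap.mem_graph_iff]; exact hz.symm⟩, ?_⟩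
      rintro S ⟨rfl | ⟨w, rfl⟩, hS⟩
      · exact absurd (by simpa using hS) hx
      · rw [LinearMap.mem_graph_iff] at hS
        have : w = z := h.injective x hx (hS.symm.trans hz.symm)
        rw [this]

theorem isLineOval (h : IsSymplecticSpreadSet B R G) {n : ℕ} (hn : Fintype.card V = 2 ^ n) :
    IsLineOval n (spreadOf R) (linesOf R G) := by
  classical
  refine ⟨?_, ?_, ?_, fun S hS => h.existsUnique_line hS⟩
  · rw [linesOf, Set.ncard_insert_of_notMem _ (Set.finite_range _), ← Set.image_univ,
      Set.ncard_image_of_injective, Set.ncard_univ, Nat.card_eq_fintype_card, hn]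
    · intro z w hzw
      exact h.injective_graph (coset_injective
        ((line_eq_coset R G z).symm.trans (hzw.trans (line_eq_coset R G w))))
    · rintro ⟨z, hz⟩
      exact vertical_ne_graph _ (coset_injective
        ((line_eq_coset R G z).symm.trans (hz.trans vertical_eq_coset))).symm
  · rintro l (rfl | ⟨z, rfl⟩)
    · exact ⟨_, Or.inl rfl, 0, vertical_eq_coset⟩
    · exact ⟨_, Or.inr ⟨z, rfl⟩, _, line_eq_coset R G z⟩
  · rintro l₁ h₁ l₂ h₂ l₃ h₃ h₁₂ h₁₃ h₂₃ ⟨⟨x, y⟩ | S, hP₁, hP₂, hP₃⟩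
    · have hinl : ∀ l : Set (V × V), Sum.inl (x, y) ∈ extendLine (spreadOf R) l ↔ (x, y) ∈ l := by
        intro l
        simp [extendLine]
      rw [hinl] at hP₁ hP₂ hP₃
      -- A point of the vertical line lies on just one further line of the oval.
      have hle : ∀ z w, y = G z + R z x → y = G w + R w x → x = 0 → z = w := by
        rintro z w hz hw rfl
        exact Finset.card_le_one.mp (h.card_lines_zero y).le z (by simpa using hz) w
          (by simpa using hw)
      have hle2 : ∀ z w t, y = G z + R z x → y = G w + R w x → y = G t + R t x →
          z = w ∨ z = t ∨ w = t := by
        intro z w t hz hw ht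
        by_contra! hne
        have h3 : 2 < (Finset.univ.filter fun z => y = G z + R z x).card := Finset.two_lt_card.mpr
          ⟨z, by simpa using hz, w, by simpa using hw, t, by simpa using ht, hne⟩
        exact absurd (h.card_lines_le x y) (by omega)
      obtain rfl | ⟨z₁, rfl⟩ := h₁ <;> obtain rfl | ⟨z₂, rfl⟩ := h₂ <;>
        obtain rfl | ⟨z₃, rfl⟩ := h₃ <;> simp only [Set.mem_ofPred_eq] at hP₁ hP₂ hP₃
      · exact h₁₂ rfl
      · exact h₁₂ rfl
      · exact h₁₃ rfl
      · exact h₂₃ (by rw [hle _ _ hP₂ hP₃ hP₁])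
      · exact h₂₃ rfl
      · exact h₁₃ (by rw [hle _ _ hP₁ hP₃ hP₂])
      · exact h₁₂ (by rw [hle _ _ hP₁ hP₂ hP₃])
      · rcases hle2 _ _ _ hP₁ hP₂ hP₃ with rfl | rfl | rfl
        · exact h₁₂ rfl
        · exact h₁₃ rfl
        · exact h₂₃ rfl
    · have hS : S ∈ spreadOf R := by
        obtain ⟨_, _, h0⟩ | ⟨T, ⟨hT, -⟩, h0⟩ := hP₁
        · cases h0
        · cases h0
          exact hT
      exact h₁₂ ((h.existsUnique_line hS).unique ⟨h₁, hP₁⟩ ⟨h₂, hP₂⟩)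

end Planes

end IsSymplecticSpreadSet

/-! ### The absolute trace and the Desarguesian case -/

section Trace

variable {K : Type*} [Field K] [Finite K] [Algebra (ZMod 2) K]

theorem trace_sq (a : K) : Algebra.trace (ZMod 2) K (a ^ 2) = Algebra.trace (ZMod 2) K a := by
  have h := Algebra.trace_eq_of_algEquiv (FiniteField.frobeniusAlgEquivOfAlgebraic (ZMod 2) K) a
  rwa [FiniteField.coe_frobeniusAlgEquivOfAlgebraic, ZMod.card] at h

theorem trace_two_pow (j : ℕ) (a : K) :
    Algebra.trace (ZMod 2) K (a ^ 2 ^ j) = Algebra.trace (ZMod 2) K a := by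
  induction j with
  | zero => simp
  | succ j ih => rw [pow_succ, pow_mul, trace_sq, ih]

theorem eq_zero_of_trace_mul_eq_zero {a : K}
    (h : ∀ b, Algebra.trace (ZMod 2) K (a * b) = 0) : a = 0 :=
  (traceForm_nondegenerate (ZMod 2) K).1 a h

/-- The trace is invariant under squaring; this is why `G` involves square roots. -/
theorem trace_sqrtTwo_mul {K : Type*} [Field K] [Fintype K] [Algebra (ZMod 2) K]
    (h : 2 ∣ Fintype.card K) (z x : K) :
    Algebra.trace (ZMod 2) K (sqrtTwo z * x) = Algebra.trace (ZMod 2) K (x * (x * z)) := by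
  rw [← trace_sq, mul_pow, sqrtTwo_sq h]
  congr 1
  ring

theorem charP_two (K : Type*) [Field K] [Algebra (ZMod 2) K] : CharP K 2 :=
  charP_of_injective_algebraMap (algebraMap (ZMod 2) K).injective 2

end Trace

theorem isSymplecticSpreadSet_des (L : Type*) [Field L] [Fintype L] [Algebra (ZMod 2) L]
    (h2 : 2 ∣ Fintype.card L) :
    IsSymplecticSpreadSet (desForm L) (desMul L) sqrtTwo where
  separating _ h := eq_zero_of_trace_mul_eq_zero h
  symm x y := by simp only [desForm, Algebra.traceForm_apply, mul_comm]
  injective x hx _ _ h := mul_left_cancel₀ hx h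
  selfAdjoint z x y := by
    simp only [desForm, Algebra.traceForm_apply, desMul, LinearMap.mulRight_apply]
    congr 1
    ring
  diag z x := trace_sqrtTwo_mul h2 z x

/-! ### The Lüneburg spread set -/

section Luneburg

variable {F : Type*} [Field F] {k : ℕ}

theorem lunSigmaInv_mul (a b : F) :
    lunSigmaInv k (a * b) = lunSigmaInv k a * lunSigmaInv k b := mul_pow ..

theorem lunSigmaInv_div (a b : F) :
    lunSigmaInv k (a / b) = lunSigmaInv k a / lunSigmaInv k b := div_pow ..

theorem lunSigmaInv_sub [Algebra (ZMod 2) F] (a b : F) :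
    lunSigmaInv k (a - b) = lunSigmaInv k a - lunSigmaInv k b := by
  have := charP_two F
  exact sub_pow_char_pow a b k

theorem lunSigmaInv_ne_zero {a : F} (ha : a ≠ 0) : lunSigmaInv k a ≠ 0 := pow_ne_zero _ ha

/-- `σ²` is the Frobenius map `a ↦ a²`. -/
theorem lunSigmaInv_lunSigmaInv_sq [Fintype F] (hF : Fintype.card F = 2 ^ (2 * k + 1)) (a : F) :
    lunSigmaInv k (lunSigmaInv k a) ^ 2 = a := by
  conv_rhs => rw [← lunSigma_lunSigmaInv hF a]
  rw [lunSigma, pow_succ 2 k, pow_mul, ← lunSigmaInv]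

theorem trace_one_eq_one [Fintype F] [Algebra (ZMod 2) F]
    (hF : Fintype.card F = 2 ^ (2 * k + 1)) : Algebra.trace (ZMod 2) F 1 = 1 := by
  have hfin : Module.finrank (ZMod 2) F = 2 * k + 1 := by
    have := Module.card_eq_pow_finrank (K := ZMod 2) (V := F)
    rw [hF, ZMod.card] at this
    exact (Nat.pow_right_injective le_rfl this).symm
  have h := Algebra.trace_algebraMap (S := F) (1 : ZMod 2)
  rw [map_one, hfin] at h
  rw [h, nsmul_one]
  push_cast
  rw [show (2 : ZMod 2) = 0 from rfl, zero_mul, zero_add]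

/-- The trace obstruction to the vanishing of `det (M_z - M_w)`. -/
theorem ne_sq_add_sq [Fintype F] [Algebra (ZMod 2) F]
    (hF : Fintype.card F = 2 ^ (2 * k + 1)) (u v : F) :
    v ≠ (lunSigmaInv k v + (u + lunSigmaInv k u - 1)) ^ 2 := by
  intro h
  -- Under the trace, `v` cancels and `u` occurs twice, leaving `0 = tr 1 = 1`.
  have h1 := congrArg (Algebra.trace (ZMod 2) F) h
  rw [trace_sq, map_add, map_sub, map_add, lunSigmaInv, lunSigmaInv, trace_two_pow,
    trace_two_pow, trace_one_eq_one hF] at h1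
  generalize Algebra.trace (ZMod 2) F v = a at h1
  generalize Algebra.trace (ZMod 2) F u = b at h1
  revert a b
  decide

theorem eq_of_det_eq_zero [Fintype F] [Algebra (ZMod 2) F]
    (hF : Fintype.card F = 2 ^ (2 * k + 1)) {z w : Fin 2 → F}
    (h : (lunMatrix k z - lunMatrix k w).det = 0) : z = w := by
  obtain ⟨a, ha⟩ : ∃ a, a = z 0 - w 0 := ⟨_, rfl⟩
  obtain ⟨t, ht⟩ : ∃ t, t = z 1 - w 1 := ⟨_, rfl⟩
  have hw0 : w 0 = z 0 - a := by rw [ha]; ring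
  have hw1 : w 1 = z 1 - t := by rw [ht]; ring
  have h1 : a * t = (lunSigmaInv k a + (z 1 * lunSigmaInv k t + t * lunSigmaInv k (z 1) -
      t * lunSigmaInv k t)) ^ 2 := by
    simp only [Matrix.det_fin_two, lunMatrix, Matrix.sub_apply, Matrix.of_apply,
      Matrix.cons_val_zero, Matrix.cons_val_one, Matrix.cons_val', Matrix.cons_val_fin_one,
      hw0, hw1, lunSigmaInv_sub] at h
    linear_combination h
  have ht0 : t = 0 := by
    by_contra ht0
    -- Divide `h1` by `(t · t^σ⁻¹)²`: with `u = z₂/t` and `v = a/(t (t^σ⁻¹)²)` it becomes the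
    -- equation excluded by `ne_sq_add_sq`.
    have hp := lunSigmaInv_ne_zero (k := k) ht0
    have hpp := lunSigmaInv_lunSigmaInv_sq hF t
    apply ne_sq_add_sq hF (z 1 / t) (a / (t * lunSigmaInv k t ^ 2))
    have h2 : lunSigmaInv k (a / (t * lunSigmaInv k t ^ 2)) =
        lunSigmaInv k a / (lunSigmaInv k t * t) := by
      rw [lunSigmaInv_div, lunSigmaInv_mul, pow_two, lunSigmaInv_mul, ← pow_two, hpp]
    rw [h2, lunSigmaInv_div]
    field_simp
    linear_combination h1
  have ha0 : a = 0 := by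
    by_contra ha0
    have hp := lunSigmaInv_ne_zero (k := k) ha0
    have h0 : lunSigmaInv k (0 : F) = 0 := by simp [lunSigmaInv]
    rw [ht0, h0] at h1
    simp only [mul_zero, zero_mul, add_zero, sub_zero] at h1
    exact pow_ne_zero 2 hp h1.symm
  funext i
  fin_cases i
  · simp [hw0, ha0]
  · simp [hw1, ht0]

theorem lunForm_apply [Algebra (ZMod 2) F] (x y : Fin 2 → F) :
    lunForm F x y = Algebra.trace (ZMod 2) F (x 0 * y 0 + x 1 * y 1) := by
  simp [lunForm, dotProduct, Fin.sum_univ_two]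

theorem lunD_eq [Fintype F] (z : Fin 2 → F) :
    lunD F k z = ![sqrtTwo (z 0), sqrtTwo (z 1)] := by
  funext i
  fin_cases i <;> simp [lunD, diagSqrt, lunMatrix]

theorem lunMul_apply_zero [Algebra (ZMod 2) F] (z x : Fin 2 → F) :
    lunMul F k z x 0 =
      x 0 * z 0 + x 1 * (lunSigmaInv k (z 0) + z 1 * lunSigmaInv k (z 1)) := by
  simp [lunMul_apply, Matrix.vecMul, dotProduct, Fin.sum_univ_two, lunMatrix]

theorem lunMul_apply_one [Algebra (ZMod 2) F] (z x : Fin 2 → F) :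
    lunMul F k z x 1 =
      x 0 * (lunSigmaInv k (z 0) + z 1 * lunSigmaInv k (z 1)) + x 1 * z 1 := by
  simp [lunMul_apply, Matrix.vecMul, dotProduct, Fin.sum_univ_two, lunMatrix]

theorem isSymplecticSpreadSet_lun [Fintype F] [Algebra (ZMod 2) F]
    (hF : Fintype.card F = 2 ^ (2 * k + 1)) :
    IsSymplecticSpreadSet (lunForm F) (lunMul F k) (lunD F k) where
  separating x h := by
    funext i
    apply eq_zero_of_trace_mul_eq_zero
    intro b
    have hb := h (Pi.single i b)
    rw [lunForm_apply] at hb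
    fin_cases i <;> simpa using hb
  symm x y := by simp only [lunForm_apply, mul_comm]
  injective x hx z w h := by
    apply eq_of_det_eq_zero hF
    refine Matrix.exists_vecMul_eq_zero_iff.mp ⟨x, hx, ?_⟩
    rw [Matrix.vecMul_sub, sub_eq_zero]
    exact h
  selfAdjoint z x y := by
    simp only [lunForm_apply, lunMul_apply_zero, lunMul_apply_one]
    congr 1
    ring
  diag z x := by
    have h2 : 2 ∣ Fintype.card F := by rw [hF]; exact dvd_pow_self 2 (by omega)
    have := charP_two F
    rw [lunForm_apply, lunForm_apply, lunD_eq, lunMul_apply_zero, lunMul_apply_one]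
    simp only [Matrix.cons_val_zero, Matrix.cons_val_one]
    rw [map_add, trace_sqrtTwo_mul h2, trace_sqrtTwo_mul h2, ← map_add]
    congr 1
    -- By symmetry of the matrix the off-diagonal term occurs twice, hence vanishes.
    linear_combination (-(x 0 * x 1 * (lunSigmaInv k (z 0) + z 1 * lunSigmaInv k (z 1)))) *
      CharTwo.two_eq_zero (R := F)

end Luneburg

/-! ### Trace-orthonormal coordinates -/

section Coordinates

variable {F L : Type*} [Field F] [Fintype F] [Algebra (ZMod 2) F] [Field L] [Fintype L]
  [Algebra (ZMod 2) L] [Algebra F L]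

theorem isScalarTower_zmod (F L : Type*) [Field F] [Algebra (ZMod 2) F] [Field L]
    [Algebra (ZMod 2) L] [Algebra F L] : IsScalarTower (ZMod 2) F L :=
  IsScalarTower.of_algebraMap_eq' (Subsingleton.elim _ _)

theorem algebraMap_trace_of_finrank_eq_two {F L : Type*} [Field F] [Fintype F] [Field L]
    [Finite L] [Algebra F L] (hL : Module.finrank F L = 2) (a : L) :
    algebraMap F L (Algebra.trace F L a) = a + a ^ Fintype.card F := by
  rw [FiniteField.algebraMap_trace_eq_sum_pow, hL, Finset.sum_range_succ, Finset.sum_range_one,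
    Nat.card_eq_fintype_card, pow_zero, pow_one, pow_one]

theorem relTrace_sq {F L : Type*} [Field F] [Fintype F] [Field L] [Finite L]
    [Algebra (ZMod 2) L] [Algebra F L] (hL : Module.finrank F L = 2) (a : L) :
    Algebra.trace F L (a ^ 2) = Algebra.trace F L a ^ 2 := by
  have := charP_two L
  apply (algebraMap F L).injective
  rw [RingHom.map_pow, algebraMap_trace_of_finrank_eq_two hL, algebraMap_trace_of_finrank_eq_two hL,
    CharTwo.add_sq, ← pow_mul, ← pow_mul, mul_comm 2]

/-- Any `a` with `T(a) = 1` gives the basis `a, 1 + a`: `T(1) = 2 = 0` and `T(a + a²) = T(a) + T(a)²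
= 0`. -/
theorem exists_traceOrthonormal (hL : Module.finrank F L = 2) :
    ∃ e : Module.Basis (Fin 2) F L, IsTraceOrthonormal e := by
  have := charP_two F
  have := charP_two L
  obtain ⟨a, ha⟩ := Algebra.trace_surjective F L 1
  have h1 : Algebra.trace F L 1 = 0 := by
    have h := Algebra.trace_algebraMap (S := L) (1 : F)
    rw [map_one, hL, two_nsmul, CharTwo.add_self_eq_zero] at h
    exact h
  have hb : Algebra.trace F L (1 + a) = 1 := by rw [map_add, h1, ha, zero_add]
  have hab : Algebra.trace F L (a * (1 + a)) = 0 := by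
    rw [mul_add, mul_one, ← pow_two, map_add, relTrace_sq hL, ha, one_pow,
      CharTwo.add_self_eq_zero]
  have hT : ∀ i j, Algebra.trace F L (![a, 1 + a] i * ![a, 1 + a] j) = if i = j then 1 else 0 := by
    intro i j
    fin_cases i <;> fin_cases j
    · simp [← pow_two, relTrace_sq hL, ha]
    · simpa using hab
    · simpa [mul_comm] using hab
    · simp [← pow_two, relTrace_sq hL, hb]
  have hli : LinearIndependent F ![a, 1 + a] := by
    rw [Fintype.linearIndependent_iff]
    intro g hg j
    have h := congrArg (fun x => Algebra.trace F L (x * ![a, 1 + a] j)) hg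
    -- Pairing the relation with the `j`-th vector isolates `g j`.
    simpa only [Finset.sum_mul, map_sum, smul_mul_assoc, map_smul, hT, smul_eq_mul, mul_ite,
      mul_one, mul_zero, Finset.sum_ite_eq', Finset.mem_univ, if_true, zero_mul, map_zero] using h
  refine ⟨basisOfLinearIndependentOfCardEqFinrank hli (by simp [hL]), fun i j => ?_⟩
  rw [coe_basisOfLinearIndependentOfCardEqFinrank]
  exact hT i j

/-- Orthonormality gives `T(xy) = x · y` in coordinates; transitivity of the trace does the rest. -/
theorem desForm_coordMap {e : Module.Basis (Fin 2) F L} (he : IsTraceOrthonormal e)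
    (p : (Fin 2 → F) × (Fin 2 → F)) :
    desForm L (coordMap e p).1 (coordMap e p).2 = lunForm F p.1 p.2 := by
  have := isScalarTower_zmod F L
  have := Module.Basis.finiteDimensional_of_finite e
  have h : ∀ x y : Fin 2 → F, Algebra.trace F L (e.equivFun.symm x * e.equivFun.symm y) =
      x 0 * y 0 + x 1 * y 1 := by
    intro x y
    have h00 := he 0 0
    have h01 := he 0 1
    have h10 := he 1 0
    have h11 := he 1 1
    simp only [Module.Basis.equivFun_symm_apply, Fin.sum_univ_two, add_mul, mul_add,
      smul_mul_smul_comm, map_add, map_smul, h00, h01, h10, h11]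
    simp
  rw [lunForm_apply, ← h, Algebra.trace_trace]
  rfl

end Coordinates

/-! ### Inequivalence of the spreads -/

section Inequivalence

variable {F L : Type*} [Field F] [Algebra (ZMod 2) F] [Field L] [Algebra (ZMod 2) L]

/-- With `smul_mem_of_mem_desSpread`: the elements of the spread are `L`-lines of `L²`. -/
theorem exists_smul_of_mem_desSpread {S : Submodule (ZMod 2) (L × L)} (hS : S ∈ desSpread L)
    {u v : L × L} (hu : u ∈ S) (hu0 : u ≠ 0) (hv : v ∈ S) : ∃ c : L, v = c • u := by
  obtain rfl | ⟨z, rfl⟩ := hS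
  · simp only [Submodule.mem_prod, Submodule.mem_bot] at hu hv
    have h0 : u.2 ≠ 0 := fun h => hu0 (Prod.ext hu.1 h)
    exact ⟨v.2 / u.2, Prod.ext (by simp [hu.1, hv.1]) (by simp [h0])⟩
  · simp only [LinearMap.mem_graph_iff, desMul, LinearMap.mulRight_apply] at hu hv
    have h0 : u.1 ≠ 0 := fun h => hu0 (Prod.ext h (by rw [hu, h]; simp))
    refine ⟨v.1 / u.1, Prod.ext (by simp [h0]) ?_⟩
    rw [hv, Prod.smul_snd, hu, smul_eq_mul]
    field_simp

theorem smul_mem_of_mem_desSpread {S : Submodule (ZMod 2) (L × L)} (hS : S ∈ desSpread L)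
    {u : L × L} (hu : u ∈ S) (c : L) : c • u ∈ S := by
  obtain rfl | ⟨z, rfl⟩ := hS
  · simp only [Submodule.mem_prod, Submodule.mem_bot] at hu ⊢
    simp [hu.1]
  · simp only [LinearMap.mem_graph_iff, desMul, LinearMap.mulRight_apply] at hu ⊢
    simp [hu, mul_assoc]

/-- A spread set containing `0` of a spread equivalent to a Desarguesian one is closed under
addition. -/
theorem exists_eq_add_of_spreadEquivalent {V : Type*} [AddCommGroup V] [Module (ZMod 2) V]
    {R : V → V →ₗ[ZMod 2] V} (hR : ∀ x ≠ 0, Function.Surjective fun z => R z x) (h0 : ∃ o, R o = 0)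
    {x₀ : V} (hx₀ : x₀ ≠ 0) (h : SpreadEquivalent (spreadOf R) (desSpread L)) (z w : V) :
    ∃ t, R t = R z + R w := by
  obtain ⟨e, he⟩ := h
  have hmem : ∀ S ∈ spreadOf R, S.map (e : V × V →ₗ[ZMod 2] L × L) ∈ desSpread L :=
    fun S hS => he ▸ Set.mem_image_of_mem _ hS
  have hgraph : ∀ z, (R z).graph.map (e : V × V →ₗ[ZMod 2] L × L) ∈ desSpread L :=
    fun z => hmem _ (Or.inr ⟨z, rfl⟩)
  have hin : ∀ z x, e (x, R z x) ∈ (R z).graph.map (e : V × V →ₗ[ZMod 2] L × L) :=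
    fun z x => Submodule.mem_map_of_mem (by simp [LinearMap.mem_graph_iff])
  obtain ⟨o, ho⟩ := h0
  -- The scalar `c` is read off from the element `y = 0` and does not depend on `z`; so `R_z(x)`
  -- depends additively on `R_z(x₀)`.
  have key : ∀ x, ∃ c : L, ∀ z, e (0, R z x) = c • e (0, R z x₀) := by
    intro x
    have hx := hin o x
    have hx' := hin o x₀
    rw [ho, LinearMap.zero_apply] at hx hx'
    obtain ⟨c, hc⟩ := exists_smul_of_mem_desSpread (u := e (x₀, 0)) (v := e (x, 0))
      (hgraph o) (by rwa [ho])
      (by simpa using hx₀) (by rwa [ho])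
    refine ⟨c, fun z => ?_⟩
    obtain ⟨⟨x', y'⟩, hm, hxy⟩ := smul_mem_of_mem_desSpread (hgraph z) (hin z x₀) c
    have hvert : e (0, R z x₀) ∈ (Submodule.prod (⊥ : Submodule (ZMod 2) V)
        (⊤ : Submodule (ZMod 2) V)).map (e : V × V →ₗ[ZMod 2] L × L) :=
      Submodule.mem_map_of_mem (by simp)
    obtain ⟨⟨a, b⟩, hab, hy⟩ := smul_mem_of_mem_desSpread (hmem _ (Or.inl rfl)) hvert c
    have hm' : y' = R z x' := hm
    have ha : a = 0 := by simpa using (Submodule.mem_prod.mp hab).1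
    subst ha hm'
    simp only [LinearEquiv.coe_coe] at hxy hy
    -- Scale `(x₀, R_z(x₀)) = (x₀, 0) + (0, R_z(x₀))` by `c`: the three vectors stay in their spread
    -- elements, and comparing components gives `x' = x`, `b = R_z(x)`.
    have hsum : e (x', R z x') = e (x, b) := by
      rw [hxy, show ((x, b) : V × V) = (x, 0) + (0, b) by simp, map_add, hy, hc, ← smul_add,
        ← map_add]
      simp
    have := e.injective hsum
    simp only [Prod.mk.injEq] at this
    rw [← hy, ← this.2, this.1]
  obtain ⟨t, ht⟩ := hR x₀ hx₀ (R z x₀ + R w x₀)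
  refine ⟨t, LinearMap.ext fun x => ?_⟩
  obtain ⟨c, hc⟩ := key x
  have hsum : e (0, R t x) = e (0, R z x + R w x) := by
    have hadd : ∀ a b : V, e (0, a + b) = e (0, a) + e (0, b) := fun a b => by
      rw [← map_add, Prod.mk_add_mk, add_zero]
    rw [hc, show R t x₀ = R z x₀ + R w x₀ from ht, hadd, smul_add, ← hc, ← hc, hadd]
  exact congrArg Prod.snd (e.injective hsum)

/-- `X^(2^k) - X` is nonzero for `k ≥ 1` and has at most `2^k < |F|` roots. -/
theorem exists_two_pow_ne {F : Type*} [Field F] [Fintype F] {k : ℕ} (hF : Fintype.card F = 2 ^ (2 * k + 1))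
    (hk : 1 ≤ k) : ∃ a : F, a ^ 2 ^ k ≠ a := by
  by_contra! h
  have hlt : 1 < 2 ^ k := Nat.one_lt_two_pow (by omega)
  have hcard := Polynomial.card_le_degree_of_subset_roots
    (p := (Polynomial.X ^ 2 ^ k - Polynomial.X : Polynomial F)) (Z := Finset.univ) (by
      intro a _
      rw [Polynomial.mem_roots (FiniteField.X_pow_card_sub_X_ne_zero F hlt)]
      simp [h a])
  rw [FiniteField.X_pow_card_sub_X_natDegree_eq F hlt, Finset.card_univ, hF] at hcard
  exact absurd hcard (not_le.mpr (Nat.pow_lt_pow_right one_lt_two (by omega)))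

theorem not_spreadEquivalent [Fintype F] {k : ℕ} (hF : Fintype.card F = 2 ^ (2 * k + 1))
    (hk : 1 ≤ k) : ¬ SpreadEquivalent (lunSpread F k) (desSpread L) := by
  intro h
  obtain ⟨a, ha⟩ := exists_two_pow_ne hF hk
  have hz : lunSigmaInv k (0 : F) = 0 := by simp [lunSigmaInv]
  have hone : lunSigmaInv k (1 : F) = 1 := by simp [lunSigmaInv]
  have hneg : lunSigmaInv k (a + 1) = lunSigmaInv k a + 1 := by
    have := charP_two F
    rw [← hone]
    simpa [lunSigmaInv] using add_pow_char_pow a (1 : F) (p := 2) (n := k)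
  have hx₀ : (![1, 0] : Fin 2 → F) ≠ 0 := fun h => one_ne_zero (congrFun h 0)
  have ho : lunMul F k 0 = 0 := by
    refine LinearMap.ext fun x => funext fun i => ?_
    fin_cases i
    · simp [lunMul_apply_zero, hz]
    · simp [lunMul_apply_one, hz]
  -- The diagonal forces `t = (0, a + 1)`; the off-diagonal entry then gives `a^σ⁻¹ + a = 0`,
  -- contrary to the choice of `a`.
  obtain ⟨t, ht⟩ := exists_eq_add_of_spreadEquivalent
    (fun x hx => ((isSymplecticSpreadSet_lun hF).bijective hx).2) ⟨0, ho⟩ hx₀ h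
    ![0, a] ![0, 1]
  have h0 := congrFun (LinearMap.congr_fun ht ![1, 0]) 0
  have h1 := congrFun (LinearMap.congr_fun ht ![1, 0]) 1
  have h2 := congrFun (LinearMap.congr_fun ht ![0, 1]) 1
  simp only [LinearMap.add_apply, Pi.add_apply, lunMul_apply_zero, lunMul_apply_one,
    Matrix.cons_val_zero, Matrix.cons_val_one, hz, hone, one_mul, zero_mul, add_zero,
    zero_add, mul_zero] at h0 h1 h2
  rw [h0, h2, hz, hneg, zero_add] at h1
  refine ha ?_
  have := charP_two F
  have h3 : lunSigmaInv k a + a = 0 := by linear_combination h1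
  rwa [← CharTwo.sub_eq_add, sub_eq_zero] at h3

end Inequivalence

end SpreadBent

theorem mainTheorem7 {F L : Type*} [Field F] [Fintype F] [Algebra (ZMod 2) F]
    [Field L] [Fintype L] [Algebra (ZMod 2) L] [Algebra F L]
    (k : ℕ) (hF : Fintype.card F = 2 ^ (2 * k + 1)) (hL : Module.finrank F L = 2) :
    -- the Desarguesian spread, its line oval and its bent function
    (IsSpread (2 * (2 * k + 1)) (desSpread L) ∧
      IsSymplectic (desForm L) (desSpread L) ∧
      IsLineOval (2 * (2 * k + 1)) (desSpread L) (desOval L) ∧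
      ((∀ y, desBent L (0, y) = 0) ∧
        ∀ x z, desBent L (x, x * z) = Algebra.trace (ZMod 2) L (sqrtTwo z * x)) ∧
      LinearOnElements (desSpread L) (desBent L) ∧
      IsBent (desForm L) (desBent L) ∧
      IsDual (desForm L) (desBent L)
        (fun p => 1 + (pointsOn (desOval L)).indicator 1 p.swap) ∧
      pointsOn (desOval L) = singularSet (quadForm (desForm L)) ∧
      (∀ x y, desBent L (x, y) = Algebra.trace (ZMod 2) L (x * y)) ∧
      IsDual (desForm L) (desBent L) (fun p => Algebra.trace (ZMod 2) L (p.1 * p.2))) ∧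
    -- the Lüneburg spread, its line oval and its bent function
    (IsSpread (2 * (2 * k + 1)) (lunSpread F k) ∧
      IsSymplectic (lunForm F) (lunSpread F k) ∧
      (∀ z, lunD F k z = ![sqrtTwo (z 0), sqrtTwo (z 1)]) ∧
      IsLineOval (2 * (2 * k + 1)) (lunSpread F k) (lunOval F k) ∧
      ((∀ y, lunBent F k (0, y) = 0) ∧
        ∀ x z, lunBent F k (x, Matrix.vecMul x (lunMatrix k z)) =
          Algebra.trace (ZMod 2) F (dotProduct (lunD F k z) x)) ∧
      LinearOnElements (lunSpread F k) (lunBent F k) ∧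
      IsBent (lunForm F) (lunBent F k) ∧
      IsDual (lunForm F) (lunBent F k)
        (fun p => 1 + (pointsOn (lunOval F k)).indicator 1 p.swap) ∧
      pointsOn (lunOval F k) = singularSet (quadForm (lunForm F))) ∧
    -- the two quadratic forms are the same, in coordinates of any trace-orthonormal basis
    ((∃ e : Module.Basis (Fin 2) F L, IsTraceOrthonormal e) ∧
      ∀ e : Module.Basis (Fin 2) F L, IsTraceOrthonormal e →
        (∀ p, quadForm (desForm L) (coordMap e p) = quadForm (lunForm F) p) ∧
        coordMap e '' pointsOn (lunOval F k) = pointsOn (desOval L)) ∧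
    -- the two bent functions are EA-equivalent
    EAEquivalent (lunBent F k) (desBent L) ∧
    -- the two spreads are inequivalent, except over the field with two elements
    (1 ≤ k → ¬ SpreadEquivalent (lunSpread F k) (desSpread L)) := by
  have hcard : Fintype.card L = 2 ^ (2 * (2 * k + 1)) := by
    rw [Module.card_eq_pow_finrank (K := F) (V := L), hL, hF, ← pow_mul, mul_comm]
  have hcardF : Fintype.card (Fin 2 → F) = 2 ^ (2 * (2 * k + 1)) := by
    rw [Fintype.card_fun, Fintype.card_fin, hF, ← pow_mul, mul_comm]
  have hD := isSymplecticSpreadSet_des L (by rw [hcard]; exact dvd_pow_self 2 (by omega))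
  have hU := isSymplecticSpreadSet_lun hF
  have hquad : ∀ e : Module.Basis (Fin 2) F L, IsTraceOrthonormal e → ∀ p,
      quadForm (desForm L) (coordMap e p) = quadForm (lunForm F) p :=
    fun e he p => desForm_coordMap he p
  obtain ⟨e, he⟩ := exists_traceOrthonormal (F := F) (L := L) hL
  refine ⟨⟨hD.isSpread hcard, hD.isSymplectic, hD.isLineOval hcard,
      ⟨fun y => by rw [desBent, hD.bentOf_apply]; simp, fun x z => hD.bentOf_graph x z⟩,
      hD.linearOnElements, hD.isBent, hD.isDual_indicator, hD.pointsOn_linesOf,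
      fun x y => hD.bentOf_apply (x, y), hD.isDual_form⟩,
    ⟨hU.isSpread hcardF, hU.isSymplectic, lunD_eq, hU.isLineOval hcardF,
      ⟨fun y => by rw [lunBent, hU.bentOf_apply]; simp, fun x z => hU.bentOf_graph x z⟩,
      hU.linearOnElements, hU.isBent, hU.isDual_indicator, hU.pointsOn_linesOf⟩,
    ⟨⟨e, he⟩, fun e he => ⟨hquad e he, ?_⟩⟩, ?_, fun hk => not_spreadEquivalent hF hk⟩
  · rw [lunOval, desOval, hU.pointsOn_linesOf, hD.pointsOn_linesOf]
    ext v
    constructor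
    · rintro ⟨p, hp, rfl⟩
      exact (hquad e he p).trans hp
    · intro hv
      refine ⟨(coordMap e).symm v, ?_, LinearEquiv.apply_symm_apply _ _⟩
      have := hquad e he ((coordMap e).symm v)
      rw [LinearEquiv.apply_symm_apply] at this
      exact this.symm.trans hv
  · have := isScalarTower_zmod F L
    -- Both functions are the forms `B(x, y)` themselves, so a linear map suffices and the affine
    -- summand is `0`.
    refine ⟨((coordMap e).symm.restrictScalars (ZMod 2)).toAffineEquiv, 0, fun w => ?_⟩
    have h := desForm_coordMap he ((coordMap e).symm w)
    rw [LinearEquiv.apply_symm_apply] at h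
    rw [desBent, lunBent, hD.bentOf_apply, hU.bentOf_apply, h]
    simp
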